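/- Let $q$ be even (a power of $2$). A (parabolic) quasi-quadric in $\mathrm{PG}(4,q)$ with nucleus the point $N$ is a set $\mathcal{Q}$ of $q^3+q^2+q+1$ points of $\mathrm{PG}(4,q)$ such that every line through $N$ contains a unique point of $\mathcal{Q}$ and every solid (3-dimensional projective subspace) not containing $N$ meets $\mathcal{Q}$ in $q^2+1$ or $(q+1)^2$ points. Let $\mathcal{Q}$ be a quasi-quadric in $\mathrm{PG}(4,q)$, and let $\mathcal{H}$ be the set of solids that meet $\mathcal{Q}$ in exactly $(q+1)^2$ points. Then $\mathcal{H}$ satisfies the condition (I) every point of $\mathrm{PG}(4,q)$ lies in either $0$, $\frac12 q^3$ or $\frac12(q^3+q^2)$ solids of $\mathcal{H}$. In particular, every quasi-quadric in $\mathrm{PG}(4,2)$ is a non-singular quadric, that is, the set of points at which some quadratic form $Q$ on $\mathbb{F}_2^5$ vanishes, where no nonzero vector $v$ satisfies both $Q(v)=0$ and $Q(v+w)=Q(w)$ for all $w$. -/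

import Mathlib

open scoped LinearAlgebra.Projectivization

/-- The points of the projective space `PG(n, q)`, where `q` is the order of the field `K`. -/
abbrev PG (n : ℕ) (K : Type*) [Field K] : Type _ := ℙ K (Fin (n + 1) → K)

/-- The projective subspaces of `PG(n, q)` of projective dimension `k`
(vector space dimension `k + 1`). -/
abbrev PGFlat (n k : ℕ) (K : Type*) [Field K] : Type _ :=
  {W : Projectivization.Subspace K (Fin (n + 1) → K) //
    Module.finrank K (Projectivization.Subspace.submodule W) = k + 1}

/-- The lines of `PG(4, q)`. -/
abbrev PGLine (K : Type*) [Field K] : Type _ := PGFlat 4 1 K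

/-- The solids (three-dimensional subspaces, i.e. hyperplanes) of `PG(4, q)`. -/
abbrev PGSolid (K : Type*) [Field K] : Type _ := PGFlat 4 3 K

/-- `𝒬` is a (parabolic) quasi-quadric of `PG(4, q)` with nucleus `N`, where `q = |K|`:
it has `(q ^ 4 - 1) / (q - 1) = q ^ 3 + q ^ 2 + q + 1` points, every line on `N` contains a unique
point of `𝒬`, and every solid not on `N` meets `𝒬` in `q ^ 2 + 1` or `(q + 1) ^ 2` points. -/
structure IsQuasiQuadric {K : Type*} [Field K] (N : PG 4 K) (𝒬 : Set (PG 4 K)) : Prop where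
  ncard_eq : 𝒬.ncard = Nat.card K ^ 3 + Nat.card K ^ 2 + Nat.card K + 1
  existsUnique_of_line : ∀ ℓ : PGLine K, N ∈ ℓ.1 → ∃! P : PG 4 K, P ∈ ℓ.1 ∧ P ∈ 𝒬
  ncard_inter_solid : ∀ S : PGSolid K, N ∉ S.1 →
    (𝒬 ∩ (S.1 : Set (PG 4 K))).ncard = Nat.card K ^ 2 + 1 ∨
    (𝒬 ∩ (S.1 : Set (PG 4 K))).ncard = (Nat.card K + 1) ^ 2

/-- Condition (I) for a set `ℋ` of solids of `PG(4, q)`: every point lies in `0`, `q ^ 3 / 2` or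
`(q ^ 3 + q ^ 2) / 2` solids of `ℋ` (the divisions are exact divisions of rational numbers). -/
def ConditionI {K : Type*} [Field K] (ℋ : Set (PGSolid K)) : Prop :=
  ∀ P : PG 4 K,
    (({S ∈ ℋ | P ∈ S.1}.ncard : ℕ) : ℚ) = 0 ∨
    (({S ∈ ℋ | P ∈ S.1}.ncard : ℕ) : ℚ) = (1 / 2) * (Nat.card K : ℚ) ^ 3 ∨
    (({S ∈ ℋ | P ∈ S.1}.ncard : ℕ) : ℚ) = (1 / 2) * ((Nat.card K : ℚ) ^ 3 + (Nat.card K : ℚ) ^ 2)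

/-- `𝒬` is (the point set of) a non-singular quadric of `PG(n, q)`: the set of points at which
a non-singular quadratic form `Q` vanishes. Non-singular means that no nonzero vector `v` satisfies
both `Q v = 0` and `Q (v + w) = Q w` for all `w` (so a nucleus is allowed in characteristic two). -/
def IsNonsingularQuadric {n : ℕ} {K : Type*} [Field K] (𝒬 : Set (PG n K)) : Prop :=
  ∃ Q : QuadraticForm K (Fin (n + 1) → K), Q.radical = ⊥ ∧ 𝒬 = {P : PG n K | Q P.rep = 0}

/-!
Let `n` represent the nucleus `N`. The solids not on `N` are the kernels of the functionals `φ` with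
`φ n = 1` (`exists_equiv_solid_notMem`), so that the solids not on `N` through given points are
counted by fibres of linear maps on the dual space. A solid on `N` has fewer than `(q + 1) ^ 2`
points of `𝒬` (`IsQuasiQuadric.ncard_inter_solid_ne`) and hence plays no role.

Fix a point `P ≠ N`, on `h` solids of `ℋ`. Among the `q ^ 3` solids on `P` but not on `N`, the ones
in `ℋ` have `(q + 1) ^ 2` points of `𝒬` and the others `q ^ 2 + 1`. On the other hand, every point of
`𝒬` off the line `NP` is on `q ^ 2` of them, while the point of `𝒬` on the line `NP` is on all of them
if it is `P` and on none otherwise. Counting incidences in two ways gives `2 q h = q ^ 4` for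
`P ∉ 𝒬` and `2 q h = q ^ 4 + q ^ 3` for `P ∈ 𝒬` (`IsQuasiQuadric.two_mul_ncard_dual`).

For `q = 2` points are nonzero vectors; let `G` be `0` at the zero vector and on `𝒬`, and `1`
elsewhere. The line condition says `G (v + n) = 1 - G v`, and the solid condition says that the
restriction of `G` to each four-dimensional complement of `⟨n⟩` is bent, of weight `6` or `10`. A bent
function of four variables has degree at most two. Concretely, comparing the two four-dimensional
complements of `⟨n⟩` that contain a given three-dimensional space shows that the latter has even
weight (`IsBentAlong.even_sum_of_linearIndependent`). So the third derivative of `G` vanishes modulo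
two (`IsBentAlong.cast_sum_seven`), which makes `G` a quadratic form. A singular vector of it would
force the weight of some four-dimensional complement to be divisible by four
(`IsBentAlong.radical_toQuadraticForm`).
-/

/-! ### Functionals and solids -/

/-- The functionals taking prescribed values on an independent family of `k` vectors form a coset
of a subspace of codimension `k` of the dual space. -/
theorem Module.Dual.natCard_of_linearIndependent {K V : Type*} [Field K] [Finite K]
    [AddCommGroup V] [Module K V] [FiniteDimensional K V] {k : ℕ} {v : Fin k → V}
    (hv : LinearIndependent K v) (c : Fin k → K) :
    Nat.card {φ : Module.Dual K V // ∀ i, φ (v i) = c i} =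
      Nat.card K ^ (Module.finrank K V - k) := by
  let T : Module.Dual K V →ₗ[K] (Fin k → K) := LinearMap.pi fun i => Module.Dual.eval K V (v i)
  have hT : Function.Surjective T := by
    intro d
    obtain ⟨φ, hφ⟩ := LinearMap.exists_extend ((Fintype.linearCombination K d).comp
      ((hv.linearCombinationEquiv.symm.trans (Finsupp.linearEquivFunOnFinite K K (Fin k))).toLinearMap))
    refine ⟨φ, funext fun i => ?_⟩
    have := LinearMap.congr_fun hφ ⟨v i, Submodule.subset_span ⟨i, rfl⟩⟩
    have h2 : hv.linearCombinationEquiv.symm ⟨v i, Submodule.subset_span ⟨i, rfl⟩⟩ =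
        Finsupp.single i 1 := by
      rw [LinearEquiv.symm_apply_eq]
      ext
      simp
    simpa [T, h2, Fintype.linearCombination_apply, Pi.single_apply] using this
  obtain ⟨φ₀, hφ₀⟩ := hT c
  have e : {φ : Module.Dual K V // ∀ i, φ (v i) = c i} ≃ LinearMap.ker T :=
    { toFun := fun φ => ⟨φ.1 - φ₀, by
        rw [LinearMap.mem_ker, map_sub, hφ₀, sub_eq_zero]; exact funext φ.2⟩
      invFun := fun ψ => ⟨ψ.1 + φ₀, fun i => by
        have h1 := congrFun hφ₀ i
        have h2 := congrFun (LinearMap.mem_ker.1 ψ.2) i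
        simp only [T, LinearMap.pi_apply, Module.Dual.eval_apply, Pi.zero_apply] at h1 h2
        simp [h1, h2]⟩
      left_inv := fun φ => by simp
      right_inv := fun ψ => by simp }
  have hr := T.finrank_range_add_finrank_ker
  rw [LinearMap.range_eq_top.2 hT, finrank_top, Module.finrank_fin_fun,
    Subspace.dual_finrank_eq] at hr
  rw [Nat.card_congr e, Module.natCard_eq_pow_finrank (K := K)]
  congr 1
  omega

theorem Projectivization.mem_subspace_iff_rep {K V : Type*} [DivisionRing K] [AddCommGroup V]
    [Module K V] (s : Projectivization.Subspace K V) (P : ℙ K V) :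
    P ∈ s ↔ P.rep ∈ Projectivization.Subspace.submodule s := by
  rw [Projectivization.Subspace.mem_submodule_iff _ P.rep_nonzero, P.mk_rep]

theorem Projectivization.linearIndependent_rep_pair {n : ℕ} {K : Type*} [Field K] {P R : PG n K}
    (h : P ≠ R) :
    LinearIndependent K ![P.rep, R.rep] :=
  Projectivization.linearIndependent_pair_iff_ne.2 h

/-- The projective subspace of dimension `k` given by a vector subspace of dimension `k + 1`. -/
def PGFlat.ofSubmodule {n k : ℕ} {K : Type*} [Field K] (W : Submodule K (Fin (n + 1) → K))
    (hW : Module.finrank K W = k + 1) : PGFlat n k K :=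
  ⟨W.projectivization, by rwa [OrderIso.apply_symm_apply]⟩

theorem PGFlat.mem_ofSubmodule {n k : ℕ} {K : Type*} [Field K]
    {W : Submodule K (Fin (n + 1) → K)} {hW : Module.finrank K W = k + 1} {P : PG n K} :
    P ∈ (PGFlat.ofSubmodule W hW).1 ↔ P.rep ∈ W := by
  rw [Projectivization.mem_subspace_iff_rep, PGFlat.ofSubmodule, OrderIso.apply_symm_apply]

theorem Module.Dual.finrank_ker_of_apply_eq_one {K : Type*} [Field K] {n : Fin (4 + 1) → K}
    {φ : Module.Dual K (Fin (4 + 1) → K)} (hφ : φ n = 1) :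
    Module.finrank K (LinearMap.ker φ) = 3 + 1 := by
  have h : φ ≠ 0 := by
    rintro rfl
    simp at hφ
  have := Module.Dual.finrank_ker_add_one_of_ne_zero h
  rw [Module.finrank_fin_fun] at this
  omega

/-- The solids not on `N` correspond to the functionals with value `1` at a representative of `N`,
a solid corresponding to the functional of which it is the kernel. -/
theorem exists_equiv_solid_notMem {K : Type*} [Field K] (N : PG 4 K) :
    ∃ e : {φ : Module.Dual K (Fin (4 + 1) → K) // φ N.rep = 1} ≃ {S : PGSolid K // N ∉ S.1},
      ∀ φ (P : PG 4 K), P ∈ (e φ).1.1 ↔ φ.1 P.rep = 0 := by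
  let f : {φ : Module.Dual K (Fin (4 + 1) → K) // φ N.rep = 1} → {S : PGSolid K // N ∉ S.1} :=
    fun φ => ⟨PGFlat.ofSubmodule (LinearMap.ker φ.1)
      (Module.Dual.finrank_ker_of_apply_eq_one φ.2), by
        rw [PGFlat.mem_ofSubmodule, LinearMap.mem_ker, φ.2]
        exact one_ne_zero⟩
  have hf : ∀ φ (P : PG 4 K), P ∈ (f φ).1.1 ↔ φ.1 P.rep = 0 := fun φ P => by
    simp only [f]
    rw [PGFlat.mem_ofSubmodule, LinearMap.mem_ker]
  refine ⟨Equiv.ofBijective f ⟨?_, ?_⟩, hf⟩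
  · rintro ⟨φ, hφ⟩ ⟨ψ, hψ⟩ h
    have h1 : LinearMap.ker φ = LinearMap.ker ψ :=
      Submodule.projectivization.injective (congrArg (fun S => S.1.1) h)
    refine Subtype.ext (LinearMap.ext fun v => ?_)
    have h2 : v - φ v • N.rep ∈ LinearMap.ker ψ := by
      rw [← h1]
      simp [hφ]
    have h3 : ψ v - φ v = 0 := by simpa [hψ] using h2
    exact (sub_eq_zero.1 h3).symm
  · rintro ⟨S, hS⟩
    have hS' := hS
    rw [Projectivization.mem_subspace_iff_rep] at hS'
    obtain ⟨φ, hφ, hle⟩ := Submodule.exists_le_ker_of_notMem hS'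
    have h1 : ((φ N.rep)⁻¹ • φ) N.rep = 1 := by simp [hφ]
    have hle' : Projectivization.Subspace.submodule S.1 ≤ LinearMap.ker ((φ N.rep)⁻¹ • φ) :=
      fun v hv => by simp [LinearMap.mem_ker.1 (hle hv)]
    refine ⟨⟨(φ N.rep)⁻¹ • φ, h1⟩, Subtype.ext (Subtype.ext ?_)⟩
    have heq := Submodule.eq_of_le_of_finrank_eq hle'
      (S.2.trans (Module.Dual.finrank_ker_of_apply_eq_one h1).symm)
    change Submodule.projectivization _ = S.1
    rw [← heq, OrderIso.symm_apply_apply]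

/-! ### Lines and solids through the nucleus -/

namespace IsQuasiQuadric

variable {K : Type*} [Field K] {N : PG 4 K} {𝒬 : Set (PG 4 K)}

theorem existsUnique_mem_span (h𝒬 : IsQuasiQuadric N 𝒬) {P : PG 4 K} (hP : P ≠ N) :
    ∃! R : PG 4 K, R.rep ∈ Submodule.span K {N.rep, P.rep} ∧ R ∈ 𝒬 := by
  have hW : Module.finrank K (Submodule.span K {N.rep, P.rep}) = 1 + 1 := by
    have := finrank_span_eq_card (Projectivization.linearIndependent_rep_pair hP.symm)
    rwa [Matrix.range_cons_cons_empty, Fintype.card_fin] at this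
  have := h𝒬.existsUnique_of_line (PGFlat.ofSubmodule _ hW)
    (PGFlat.mem_ofSubmodule.2 (Submodule.subset_span (by simp)))
  simpa only [PGFlat.mem_ofSubmodule] using this

variable [Finite K]

theorem nucleus_notMem (h𝒬 : IsQuasiQuadric N 𝒬) : N ∉ 𝒬 := by
  intro hN
  have hsub : 𝒬 ⊆ {N} := fun R hR => by
    by_contra hne
    exact hne ((h𝒬.existsUnique_mem_span hne).unique
      ⟨Submodule.subset_span (by simp), hR⟩ ⟨Submodule.subset_span (by simp), hN⟩)
  have h1 := Set.ncard_le_ncard hsub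
  rw [Set.ncard_singleton, h𝒬.ncard_eq] at h1
  have : 0 < Nat.card K ^ 2 := pow_pos Nat.card_pos 2
  omega

theorem ne_nucleus (h𝒬 : IsQuasiQuadric N 𝒬) {R : PG 4 K} (hR : R ∈ 𝒬) : R ≠ N :=
  fun h => h𝒬.nucleus_notMem (h ▸ hR)

/-- A solid on the nucleus has fewer than `(q + 1) ^ 2` points of a quasi-quadric: its lines on
the nucleus `N` with the point `N` removed are disjoint and each holds at most one point. -/
theorem ncard_inter_solid_ne (h𝒬 : IsQuasiQuadric N 𝒬) {S : PGSolid K} (hS : N ∈ S.1) :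
    (𝒬 ∩ (S.1 : Set (PG 4 K))).ncard ≠ (Nat.card K + 1) ^ 2 := by
  set q := Nat.card K with hq
  have hq2 : 2 ≤ q := Finite.one_lt_card
  set W := Projectivization.Subspace.submodule S.1 with hW
  have hmem : ∀ P : PG 4 K, P ∈ S.1 ↔ P.rep ∈ W := Projectivization.mem_subspace_iff_rep S.1
  let f : (↥(𝒬 ∩ (S.1 : Set (PG 4 K)))) × K × Kˣ → W := fun x =>
    ⟨x.2.1 • N.rep + (x.2.2 : K) • x.1.1.rep, W.add_mem (W.smul_mem _ ((hmem N).1 hS))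
      (W.smul_mem _ ((hmem _).1 x.1.2.2))⟩
  have hf : Function.Injective f := by
    rintro ⟨⟨R, hR, hRS⟩, a, b⟩ ⟨⟨R', hR', hRS'⟩, a', b'⟩ h
    have h1 : a • N.rep + (b : K) • R.rep = a' • N.rep + (b' : K) • R'.rep :=
      congrArg Subtype.val h
    have h2 : R = R' := by
      refine (h𝒬.existsUnique_mem_span (h𝒬.ne_nucleus hR')).unique ⟨?_, hR⟩
        ⟨Submodule.subset_span (by simp), hR'⟩
      have h3 : R.rep = ((b : K)⁻¹ * (a' - a)) • N.rep + ((b : K)⁻¹ * b') • R'.rep := by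
        rw [mul_smul, mul_smul, ← smul_add, eq_inv_smul_iff₀ b.ne_zero, sub_smul, sub_add_eq_add_sub,
          ← h1, add_sub_cancel_left]
      exact Submodule.mem_span_pair.2 ⟨_, _, h3.symm⟩
    subst h2
    have h4 := (Projectivization.linearIndependent_rep_pair (h𝒬.ne_nucleus hR).symm).eq_of_pair h1
    simp only [Prod.mk.injEq, true_and]
    exact ⟨h4.1, Units.ext h4.2⟩
  have h1 := Nat.card_le_card_of_injective f hf
  have h2 : Nat.card Kˣ = q - 1 := by
    rw [Nat.card_units]
  rw [Nat.card_prod, Nat.card_prod, h2, Module.natCard_eq_pow_finrank (K := K) (V := W), S.2,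
    Nat.card_coe_set_eq, ← hq] at h1
  intro h
  rw [h] at h1
  obtain ⟨r, hr⟩ : ∃ r, q = r + 2 := ⟨q - 2, by omega⟩
  rw [hr, show r + 2 - 1 = r + 1 by omega] at h1
  ring_nf at h1
  nlinarith [sq_nonneg r, pow_nonneg (Nat.zero_le r) 3]

end IsQuasiQuadric

/-! ### Counting the solids on a point -/

namespace IsQuasiQuadric

variable {K : Type*} [Field K] {N : PG 4 K} {𝒬 : Set (PG 4 K)} [Finite K]

/-- The number of solids on `P` and `R` but not on `N`, where `R` is not on the line `NP`. -/
theorem natCard_dual_of_notMem_span {P R : PG 4 K} (hP : P ≠ N)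
    (hR : R.rep ∉ Submodule.span K {N.rep, P.rep}) :
    Nat.card {φ : Module.Dual K (Fin (4 + 1) → K) //
      φ N.rep = 1 ∧ φ P.rep = 0 ∧ φ R.rep = 0} = Nat.card K ^ 2 := by
  have hv : LinearIndependent K ![R.rep, N.rep, P.rep] := by
    refine linearIndependent_finCons.2 ⟨Projectivization.linearIndependent_rep_pair hP.symm, ?_⟩
    rwa [Matrix.range_cons_cons_empty]
  have := Module.Dual.natCard_of_linearIndependent hv ![0, 1, 0]
  rw [Module.finrank_fin_fun] at this
  rw [← this]
  refine Nat.card_congr (Equiv.subtypeEquivRight fun φ => ?_)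
  simp only [Fin.forall_fin_succ, IsEmpty.forall_iff, Matrix.cons_val_zero, Matrix.cons_val_succ,
    and_true]
  tauto

theorem natCard_dual_pair {P : PG 4 K} (hP : P ≠ N) :
    Nat.card {φ : Module.Dual K (Fin (4 + 1) → K) // φ N.rep = 1 ∧ φ P.rep = 0} =
      Nat.card K ^ 3 := by
  have hv : LinearIndependent K ![N.rep, P.rep] := Projectivization.linearIndependent_rep_pair hP.symm
  have := Module.Dual.natCard_of_linearIndependent hv ![1, 0]
  rw [Module.finrank_fin_fun] at this
  rw [← this]
  refine Nat.card_congr (Equiv.subtypeEquivRight fun φ => ?_)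
  simp [Fin.forall_fin_succ]

/-- The point of `𝒬` on the line `NP` lies in no solid on `P` not on `N`, unless it is `P`. -/
theorem natCard_dual_of_mem_span (h𝒬 : IsQuasiQuadric N 𝒬) {P R : PG 4 K} (hP : P ≠ N)
    (hR : R.rep ∈ Submodule.span K {N.rep, P.rep}) (hRQ : R ∈ 𝒬) [Decidable (P ∈ 𝒬)] :
    Nat.card {φ : Module.Dual K (Fin (4 + 1) → K) //
      φ N.rep = 1 ∧ φ P.rep = 0 ∧ φ R.rep = 0} = if P ∈ 𝒬 then Nat.card K ^ 3 else 0 := by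
  split_ifs with hPQ
  · obtain rfl : R = P := (h𝒬.existsUnique_mem_span hP).unique ⟨hR, hRQ⟩
      ⟨Submodule.subset_span (by simp), hPQ⟩
    simpa only [and_self] using natCard_dual_pair hP
  · have : IsEmpty {φ : Module.Dual K (Fin (4 + 1) → K) //
        φ N.rep = 1 ∧ φ P.rep = 0 ∧ φ R.rep = 0} := by
      refine ⟨fun ⟨φ, h1, h2, h3⟩ => hPQ ?_⟩
      obtain ⟨a, b, hab⟩ := Submodule.mem_span_pair.1 hR
      rw [← hab, map_add, map_smul, map_smul, h1, h2, smul_zero, add_zero, smul_eq_mul,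
        mul_one] at h3
      rw [h3, zero_smul, zero_add] at hab
      have : R = P := by
        rw [← R.mk_rep, ← P.mk_rep, Projectivization.mk_eq_mk_iff']
        exact ⟨b, hab⟩
      exact this ▸ hRQ
    exact Nat.card_of_isEmpty

open Classical in
/-- The number `h` of solids on `P` that meet `𝒬` in `(q + 1) ^ 2` points is found by counting in
two ways the pairs of a point of `𝒬` and a solid on that point and on `P`, but not on `N`. -/
theorem two_mul_ncard_dual (h𝒬 : IsQuasiQuadric N 𝒬) {P : PG 4 K} (hP : P ≠ N) :
    2 * Nat.card K * {φ : Module.Dual K (Fin (4 + 1) → K) | φ N.rep = 1 ∧ φ P.rep = 0 ∧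
      {R ∈ 𝒬 | φ R.rep = 0}.ncard = (Nat.card K + 1) ^ 2}.ncard =
      Nat.card K ^ 4 + if P ∈ 𝒬 then Nat.card K ^ 3 else 0 := by
  set q := Nat.card K with hq
  have hq0 : 0 < q := Nat.card_pos
  have : Finite (Module.Dual K (Fin (4 + 1) → K)) := Module.finite_of_finite K
  have : Fintype (Module.Dual K (Fin (4 + 1) → K)) := Fintype.ofFinite _
  have : Fintype (PG 4 K) := Fintype.ofFinite _
  let A : Finset (Module.Dual K (Fin (4 + 1) → K)) := {φ | φ N.rep = 1 ∧ φ P.rep = 0}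
  let g : Module.Dual K (Fin (4 + 1) → K) → ℕ := fun φ => {R ∈ 𝒬 | φ R.rep = 0}.ncard
  have hg : ∀ φ, g φ = ({R ∈ 𝒬.toFinset | φ R.rep = 0} : Finset (PG 4 K)).card := fun φ => by
    simp only [g]
    rw [← Set.ncard_coe_finset]
    congr 1
    ext R
    simp
  have hA : A.card = q ^ 3 := by
    rw [hq, ← natCard_dual_pair hP, Nat.card_eq_fintype_card, Fintype.card_subtype]
  have hval : ∀ φ ∈ A, g φ = (q ^ 2 + 1) + if g φ = (q + 1) ^ 2 then 2 * q else 0 := by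
    intro φ hφ
    obtain ⟨e, he⟩ := exists_equiv_solid_notMem N
    have hφ1 : φ N.rep = 1 := (Finset.mem_filter.1 hφ).2.1
    have h1 : g φ = (𝒬 ∩ ((e ⟨φ, hφ1⟩).1.1 : Set (PG 4 K))).ncard := by
      simp only [g]
      congr 1
      ext R
      simp [he]
    have h2 := h𝒬.ncard_inter_solid _ (e ⟨φ, hφ1⟩).2
    rw [← h1] at h2
    rcases h2 with h | h
    · have hne : q ^ 2 + 1 ≠ (q + 1) ^ 2 := by
        ring_nf
        omega
      rw [h, if_neg hne, add_zero]
    · rw [h, if_pos rfl]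
      ring
  have hsum1 : ∑ φ ∈ A, g φ = q ^ 3 * (q ^ 2 + 1) + 2 * q * {φ ∈ A | g φ = (q + 1) ^ 2}.card := by
    rw [Finset.sum_congr rfl hval, Finset.sum_add_distrib, Finset.sum_const, hA, ← Finset.sum_filter,
      Finset.sum_const, smul_eq_mul, smul_eq_mul, mul_comm (Finset.card _)]
  obtain ⟨R₀, ⟨hR₀, hR₀Q⟩, huniq⟩ := h𝒬.existsUnique_mem_span hP
  have hsum2 : ∑ φ ∈ A, g φ = (q ^ 3 + q ^ 2 + q) * q ^ 2 + if P ∈ 𝒬 then q ^ 3 else 0 := by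
    have hcount : ∀ R : PG 4 K, ({φ ∈ A | φ R.rep = 0} : Finset _).card =
        Nat.card {φ : Module.Dual K (Fin (4 + 1) → K) //
          φ N.rep = 1 ∧ φ P.rep = 0 ∧ φ R.rep = 0} := fun R => by
      rw [Nat.card_eq_fintype_card, Fintype.card_subtype, Finset.filter_filter]
      simp only [and_assoc]
    have hcard : (𝒬.toFinset.erase R₀).card = q ^ 3 + q ^ 2 + q := by
      rw [Finset.card_erase_of_mem (Set.mem_toFinset.2 hR₀Q), ← Set.ncard_eq_toFinset_card',
        h𝒬.ncard_eq, ← hq]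
      omega
    rw [Finset.sum_congr rfl fun φ _ => hg φ]
    refine (Finset.sum_card_bipartiteAbove_eq_sum_card_bipartiteBelow
      (fun (φ : Module.Dual K (Fin (4 + 1) → K)) (R : PG 4 K) => φ R.rep = 0)).trans ?_
    simp only [Finset.bipartiteBelow]
    rw [← Finset.sum_erase_add _ _ (Set.mem_toFinset.2 hR₀Q), hcount,
      natCard_dual_of_mem_span h𝒬 hP hR₀ hR₀Q]
    congr 1
    rw [Finset.sum_congr rfl fun (R : PG 4 K) hR => ?_, Finset.sum_const, hcard, smul_eq_mul]
    rw [Finset.mem_erase, Set.mem_toFinset] at hR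
    rw [hcount, natCard_dual_of_notMem_span hP fun h => hR.1 (huniq R ⟨h, hR.2⟩)]
  have hset : {φ : Module.Dual K (Fin (4 + 1) → K) | φ N.rep = 1 ∧ φ P.rep = 0 ∧
      {R ∈ 𝒬 | φ R.rep = 0}.ncard = (q + 1) ^ 2}.ncard = {φ ∈ A | g φ = (q + 1) ^ 2}.card := by
    rw [← Set.ncard_coe_finset]
    congr 1
    ext φ
    simp [A, g, and_assoc]
  rw [hset]
  rw [hsum1] at hsum2
  linear_combination hsum2

theorem conditionI (h𝒬 : IsQuasiQuadric N 𝒬) :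
    ConditionI {S : PGSolid K | (𝒬 ∩ (S.1 : Set (PG 4 K))).ncard = (Nat.card K + 1) ^ 2} := by
  classical
  intro P
  rcases eq_or_ne P N with rfl | hP
  · left
    rw [Nat.cast_eq_zero, ← Set.ncard_empty (PGSolid K)]
    congr 1
    exact Set.eq_empty_of_forall_notMem fun S hS => h𝒬.ncard_inter_solid_ne hS.2 hS.1
  obtain ⟨e, he⟩ := exists_equiv_solid_notMem N
  have key := h𝒬.two_mul_ncard_dual hP
  have hcount : {S ∈ {S : PGSolid K | (𝒬 ∩ (S.1 : Set (PG 4 K))).ncard = (Nat.card K + 1) ^ 2} |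
      P ∈ S.1}.ncard = {φ : Module.Dual K (Fin (4 + 1) → K) | φ N.rep = 1 ∧ φ P.rep = 0 ∧
      {R ∈ 𝒬 | φ R.rep = 0}.ncard = (Nat.card K + 1) ^ 2}.ncard := by
    have hinter : ∀ φ, 𝒬 ∩ ((e φ).1.1 : Set (PG 4 K)) = {R ∈ 𝒬 | φ.1 R.rep = 0} := fun φ => by
      ext R
      simp [he]
    refine (Set.ncard_congr (fun φ hφ => (e ⟨φ, hφ.1⟩).1) ?_ ?_ ?_).symm
    · rintro φ ⟨h1, h2, h3⟩
      refine ⟨?_, (he _ _).2 h2⟩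
      rw [Set.mem_ofPred_eq, hinter]
      exact h3
    · intro φ ψ _ _ h
      exact congrArg Subtype.val (e.injective (Subtype.ext h))
    · rintro S ⟨h1, h2⟩
      have hS : N ∉ S.1 := fun h => h𝒬.ncard_inter_solid_ne h h1
      obtain ⟨φ, hφ⟩ := e.surjective ⟨S, hS⟩
      have hφS : (e φ).1 = S := congrArg Subtype.val hφ
      refine ⟨φ.1, ⟨φ.2, (he _ _).1 (by rwa [hφS]), ?_⟩, hφS⟩
      rw [← hinter, hφS]
      exact h1
  have hq0 : (Nat.card K : ℚ) ≠ 0 := Nat.cast_ne_zero.2 Nat.card_pos.ne'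
  rw [hcount]
  have key' := congrArg (Nat.cast (R := ℚ)) key
  push_cast at key'
  right
  split_ifs at key' with h
  · right
    refine mul_left_cancel₀ (mul_ne_zero two_ne_zero hq0) (key'.trans ?_)
    ring
  · left
    refine mul_left_cancel₀ (mul_ne_zero two_ne_zero hq0) (key'.trans ?_)
    ring

end IsQuasiQuadric

/-! ### Functions on a vector space over the field of two elements -/

section TwoElements

variable {K : Type*} [Field K]

theorem eq_zero_or_one_of_natCard_eq_two (h2 : Nat.card K = 2) (a : K) : a = 0 ∨ a = 1 := by
  by_contra! h
  have : Finite K := Nat.finite_of_card_ne_zero (by omega)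
  have h3 : ({0, 1, a} : Set K).ncard = 3 := by
    rw [Set.ncard_eq_three]
    exact ⟨0, 1, a, zero_ne_one, h.1.symm, h.2.symm, rfl⟩
  have := Set.ncard_le_card ({0, 1, a} : Set K)
  omega

theorem two_eq_zero_of_natCard_eq_two (h2 : Nat.card K = 2) : (2 : K) = 0 := by
  rcases eq_zero_or_one_of_natCard_eq_two h2 (2 : K) with h | h
  · exact h
  · rw [← one_add_one_eq_two, add_eq_right] at h
    exact absurd h one_ne_zero

theorem add_self_of_natCard_eq_two (h2 : Nat.card K = 2) {M : Type*} [AddCommGroup M] [Module K M]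
    (v : M) : v + v = 0 := by
  rw [← two_smul K, two_eq_zero_of_natCard_eq_two h2, zero_smul]

variable {V : Type*} [AddCommGroup V] [Module K V]

theorem linearCombination_vecCons {k : ℕ} (w : V) (v : Fin k → V) (a : K) (c : Fin k → K) :
    Fintype.linearCombination K (Matrix.vecCons w v) (Matrix.vecCons a c) =
      a • w + Fintype.linearCombination K v c := by
  simp [Fintype.linearCombination_apply, Fin.sum_univ_succ]

theorem linearIndependent_vecCons_exchange {n w : V} {k : ℕ} {v : Fin k → V}
    (hv : LinearIndependent K (Matrix.vecCons n v))
    (hw : w ∉ Submodule.span K (Set.range (Matrix.vecCons n v))) :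
    LinearIndependent K (Matrix.vecCons w v) ∧
      n ∉ Submodule.span K (Set.range (Matrix.vecCons w v)) := by
  obtain ⟨h1, h2⟩ := linearIndependent_finCons.1 hv
  rw [Matrix.range_cons, Set.singleton_union] at hw ⊢
  refine ⟨linearIndependent_finCons.2 ⟨h1, fun h => hw ?_⟩, fun h => hw ?_⟩
  · exact Submodule.span_mono (Set.subset_insert _ _) h
  · exact mem_span_insert_exchange h h2

variable [Fintype K]

theorem sum_of_natCard_eq_two (h2 : Nat.card K = 2) {M : Type*} [AddCommMonoid M] (f : K → M) :
    ∑ a, f a = f 0 + f 1 := by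
  classical
  have : (Finset.univ : Finset K) = {0, 1} := by
    ext a
    simpa using eq_zero_or_one_of_natCard_eq_two h2 a
  rw [this, Finset.sum_pair zero_ne_one]

theorem sum_linearCombination_vecCons (h2 : Nat.card K = 2) {M : Type*} [AddCommMonoid M]
    (G : V → M) {k : ℕ} (w : V) (v : Fin k → V) :
    ∑ c, G (Fintype.linearCombination K (Matrix.vecCons w v) c) =
      ∑ c, G (Fintype.linearCombination K v c) +
        ∑ c, G (w + Fintype.linearCombination K v c) := by
  rw [← Equiv.sum_comp (Fin.consEquiv fun _ => K), Fintype.sum_prod_type, sum_of_natCard_eq_two h2]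
  congr 1
  · refine Finset.sum_congr rfl fun c _ => congrArg G ?_
    exact (linearCombination_vecCons w v 0 c).trans (by rw [zero_smul, zero_add])
  · refine Finset.sum_congr rfl fun c _ => congrArg G ?_
    exact (linearCombination_vecCons w v 1 c).trans (by rw [one_smul])

/-- The function `G` on a space over the field of two elements takes the values `0` and `1`, changes
value under translation by `n`, and its restriction to every four-dimensional complement of `n` is
bent, in that its support there has the size `6` or `10`. -/
structure IsBentAlong (K : Type*) {V : Type*} [Field K] [Fintype K] [AddCommGroup V] [Module K V]
    (n : V) (G : V → ℤ) : Prop where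
  eq_zero_or_one : ∀ v, G v = 0 ∨ G v = 1
  add_nucleus : ∀ v, G (v + n) = 1 - G v
  sum_eq : ∀ v : Fin 4 → V, LinearIndependent K v → n ∉ Submodule.span K (Set.range v) →
    ∑ c, G (Fintype.linearCombination K v c) = 6 ∨
      ∑ c, G (Fintype.linearCombination K v c) = 10

namespace IsBentAlong

variable {n : V} {G : V → ℤ}

/-- The four-dimensional spaces on a three-dimensional space `E` that meet `⟨n⟩` trivially are
`⟨E, w⟩` and `⟨E, w + n⟩`. Their weights are each `6` or `10` and add up to twice the weight of `E`
plus the constant `8`, so that `E` has even weight. -/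
theorem even_sum_of_linearIndependent (hG : IsBentAlong K n G) (h2 : Nat.card K = 2)
    (hV : Module.finrank K V = 5) {v : Fin 3 → V}
    (hv : LinearIndependent K (Matrix.vecCons n v)) :
    Even (∑ c, G (Fintype.linearCombination K v c)) := by
  obtain ⟨w, hw⟩ := exists_linearIndependent_cons_of_lt_finrank hv (by omega)
  have hw1 := (linearIndependent_finCons.1 hw).2
  have hw2 : w + n ∉ Submodule.span K (Set.range (Matrix.vecCons n v)) := fun h =>
    hw1 (by simpa using Submodule.sub_mem _ h (Submodule.subset_span ⟨0, rfl⟩))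
  obtain ⟨h3, h4⟩ := linearIndependent_vecCons_exchange hv hw1
  obtain ⟨h5, h6⟩ := linearIndependent_vecCons_exchange hv hw2
  have s1 := hG.sum_eq _ h3 h4
  have s2 := hG.sum_eq _ h5 h6
  rw [sum_linearCombination_vecCons h2] at s1 s2
  have s3 : ∑ c, G (w + n + Fintype.linearCombination K v c) =
      8 - ∑ c, G (w + Fintype.linearCombination K v c) := by
    simp only [add_right_comm w n, hG.add_nucleus, Finset.sum_sub_distrib]
    rw [Nat.card_eq_fintype_card] at h2
    simp [h2]
  rw [s3] at s2
  rw [Int.even_iff]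
  omega

/-- The third derivative of `G` modulo two vanishes at the origin. -/
theorem cast_sum_eq_zero (hG : IsBentAlong K n G) (h2 : Nat.card K = 2)
    (hV : Module.finrank K V = 5) (v : Fin 3 → V) :
    ((∑ c, G (Fintype.linearCombination K v c) : ℤ) : K) = 0 := by
  classical
  have htwo := two_eq_zero_of_natCard_eq_two h2
  suffices h : Even (∑ c, G (Fintype.linearCombination K v c)) ∨
      ((∑ c, G (Fintype.linearCombination K v c) : ℤ) : K) = 0 by
    rcases h with ⟨m, hm⟩ | h
    · rw [hm, Int.cast_add, ← two_mul, htwo, zero_mul]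
    · exact h
  by_cases hv : LinearIndependent K (Matrix.vecCons n v)
  · exact .inl (hG.even_sum_of_linearIndependent h2 hV hv)
  by_cases hv' : LinearIndependent K v
  · -- If `n` is in the span of `v`, then `G` takes either value on half of the span.
    have hn : n ∈ Submodule.span K (Set.range v) := by
      by_contra hn
      exact hv (linearIndependent_finCons.2 ⟨hv', hn⟩)
    obtain ⟨d, hd⟩ := (Submodule.mem_span_range_iff_exists_fun K).1 hn
    rw [← Fintype.linearCombination_apply] at hd
    have h1 := Equiv.sum_comp (Equiv.addRight d) fun c => G (Fintype.linearCombination K v c)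
    simp only [Equiv.coe_addRight, map_add, hd, hG.add_nucleus, Finset.sum_sub_distrib] at h1
    have h3 : ∑ _c : Fin 3 → K, (1 : ℤ) = 8 := by
      rw [Nat.card_eq_fintype_card] at h2
      simp [h2]
    rw [h3] at h1
    left
    rw [Int.even_iff]
    omega
  · -- A linear relation on `v` makes the terms of the sum equal in pairs.
    obtain ⟨d, hd, i, hi⟩ := Fintype.not_linearIndependent_iff.1 hv'
    rw [← Fintype.linearCombination_apply] at hd
    right
    rw [Int.cast_sum]
    refine Finset.sum_involution (fun c _ => c + d) ?_ ?_ (fun _ _ => Finset.mem_univ _) ?_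
    · intro c _
      rw [map_add, hd, add_zero, ← two_mul, htwo, zero_mul]
    · intro c _ _ h
      exact hi (congrFun (add_eq_left.1 h) i)
    · intro c _
      rw [add_assoc, add_self_of_natCard_eq_two h2 d, add_zero]

theorem cast_sum_seven (hG : IsBentAlong K n G) (h2 : Nat.card K = 2)
    (hV : Module.finrank K V = 5) (hG0 : G 0 = 0) (x y z : V) :
    (G (x + y + z) + G (x + y) + G (x + z) + G (y + z) + G x + G y + G z : K) = 0 := by
  have h := hG.cast_sum_eq_zero h2 hV ![x, y, z]
  have h0 : ∀ f : V → ℤ, ∑ c, f (Fintype.linearCombination K (![] : Fin 0 → V) c) = f 0 :=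
    fun f => by simp [Fintype.linearCombination_apply]
  rw [sum_linearCombination_vecCons h2, sum_linearCombination_vecCons h2,
    sum_linearCombination_vecCons h2 (fun u => G (x + u)), sum_linearCombination_vecCons h2,
    sum_linearCombination_vecCons h2 (fun u => G (y + u)),
    sum_linearCombination_vecCons h2 (fun u => G (x + u)),
    sum_linearCombination_vecCons h2 (fun u => G (x + (y + u)))] at h
  rw [h0, h0 (fun u => G (z + u)), h0 (fun u => G (y + u)), h0 (fun u => G (y + (z + u))),
    h0 (fun u => G (x + u)), h0 (fun u => G (x + (z + u))), h0 (fun u => G (x + (y + u))),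
    h0 (fun u => G (x + (y + (z + u))))] at h
  simp only [add_zero, hG0] at h
  push_cast at h
  rw [add_assoc x y z, ← h]
  ring

/-- A function that is bent along `n` and vanishes at the origin is, modulo two, a quadratic
form. -/
def toQuadraticForm (hG : IsBentAlong K n G) (h2 : Nat.card K = 2)
    (hV : Module.finrank K V = 5) (hG0 : G 0 = 0) : QuadraticForm K V where
  toFun v := (G v : K)
  toFun_smul a x := by
    rcases eq_zero_or_one_of_natCard_eq_two h2 a with rfl | rfl <;> simp [hG0]
  exists_companion' := by
    have htwo := two_eq_zero_of_natCard_eq_two h2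
    refine ⟨LinearMap.mk₂ K (fun x y => (G (x + y) + G x + G y : K)) ?_ ?_ ?_ ?_, ?_⟩
    · intro x y z
      linear_combination hG.cast_sum_seven h2 hV hG0 x y z -
        (G (x + z) + G (y + z) + G x + G y + G z : K) * htwo
    · intro a x y
      rcases eq_zero_or_one_of_natCard_eq_two h2 a with rfl | rfl
      · simp only [zero_smul, zero_add, hG0, Int.cast_zero, add_zero]
        linear_combination (G y : K) * htwo
      · simp only [one_smul]
    · intro x y z
      rw [← add_assoc]
      linear_combination hG.cast_sum_seven h2 hV hG0 x y z -
        (G (x + y) + G (x + z) + G x + G y + G z : K) * htwo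
    · intro a x y
      rcases eq_zero_or_one_of_natCard_eq_two h2 a with rfl | rfl
      · simp only [zero_smul, hG0, Int.cast_zero, add_zero]
        linear_combination (G x : K) * htwo
      · simp only [one_smul]
    · intro x y
      simp only [LinearMap.mk₂_apply]
      linear_combination -(G x + G y : K) * htwo

/-- A singular vector `v` would give a four-dimensional space `⟨E, v⟩` with twice the weight of the
three-dimensional space `E`, a multiple of four. -/
theorem radical_toQuadraticForm (hG : IsBentAlong K n G) (h2 : Nat.card K = 2)
    (hV : Module.finrank K V = 5) (hG0 : G 0 = 0) :
    QuadraticMap.radical (hG.toQuadraticForm h2 hV hG0) = ⊥ := by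
  have hcast : ∀ u v, (G u : K) = G v → G u = G v := fun u v h => by
    rcases hG.eq_zero_or_one u with hu | hu <;> rcases hG.eq_zero_or_one v with hv | hv <;>
      rw [hu, hv] at h ⊢ <;> simp at h
  have hn1 : G n = 1 := by simpa [hG0] using hG.add_nucleus 0
  rw [Submodule.eq_bot_iff]
  intro v hv
  obtain ⟨hv0, hvadd⟩ := QuadraticMap.mem_radical_iff'.1 hv
  by_contra hne
  have hGv : G v = 0 := (hcast v 0 (by rw [hG0, Int.cast_zero]; exact hv0)).trans hG0
  have hper : ∀ u, G (v + u) = G u := fun u => hcast _ _ (hvadd u)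
  have hn0 : n ≠ 0 := by
    rintro rfl
    omega
  have hli : LinearIndependent K ![v, n] := by
    refine (LinearIndependent.pair_iff' hne).2 fun a h => ?_
    rcases eq_zero_or_one_of_natCard_eq_two h2 a with rfl | rfl
    · exact hn0 (by rw [← h, zero_smul])
    · rw [one_smul] at h
      rw [h] at hGv
      omega
  obtain ⟨x, hx⟩ := exists_linearIndependent_snoc_of_lt_finrank hli (by omega)
  obtain ⟨y, hy⟩ := exists_linearIndependent_snoc_of_lt_finrank hx (by omega)
  obtain ⟨z, hz⟩ := exists_linearIndependent_snoc_of_lt_finrank hy (by omega)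
  have hz' : LinearIndependent K (Matrix.vecCons v (Matrix.vecCons n ![x, y, z])) := by
    have h : Fin.snoc (Fin.snoc (Fin.snoc ![v, n] x) y) z =
        Matrix.vecCons v (Matrix.vecCons n ![x, y, z]) := by
      ext i : 1
      fin_cases i <;> rfl
    rwa [h] at hz
  obtain ⟨h3, h4⟩ := linearIndependent_finCons.1 hz'
  obtain ⟨h5, h6⟩ := linearIndependent_vecCons_exchange h3 h4
  have h7 := hG.sum_eq _ h5 h6
  obtain ⟨m, hm⟩ := hG.even_sum_of_linearIndependent h2 hV h3
  rw [sum_linearCombination_vecCons h2] at h7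
  simp only [hper] at h7
  omega

end IsBentAlong

end TwoElements

/-! ### Quasi-quadrics over the field of two elements -/

theorem Projectivization.rep_injective {K V : Type*} [DivisionRing K] [AddCommGroup V]
    [Module K V] : Function.Injective (Projectivization.rep : ℙ K V → V) := fun P R h => by
  rw [← P.mk_rep, ← R.mk_rep]
  simp only [h]

theorem Projectivization.rep_mk_of_natCard_eq_two {K V : Type*} [Field K] [AddCommGroup V]
    [Module K V] (h2 : Nat.card K = 2) {v : V} (hv : v ≠ 0) :
    (Projectivization.mk K v hv).rep = v := by
  obtain ⟨a, ha⟩ := Projectivization.exists_smul_eq_mk_rep K v hv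
  rw [← ha, Units.smul_def, (eq_zero_or_one_of_natCard_eq_two h2 (a : K)).resolve_left a.ne_zero,
    one_smul]

open Classical in
/-- The indicator function of the nonzero vectors that do not represent a point of `𝒬`; it is
meant for the field of two elements, where a nonzero vector is the representative of its point. -/
noncomputable def coIndicator {n : ℕ} {K : Type*} [Field K] (𝒬 : Set (PG n K))
    (v : Fin (n + 1) → K) : ℤ :=
  if v = 0 ∨ v ∈ Projectivization.rep '' 𝒬 then 0 else 1

theorem coIndicator_zero {n : ℕ} {K : Type*} [Field K] (𝒬 : Set (PG n K)) :
    coIndicator 𝒬 0 = 0 :=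
  if_pos (.inl rfl)

theorem coIndicator_rep_eq_zero {n : ℕ} {K : Type*} [Field K] {𝒬 : Set (PG n K)} {P : PG n K} :
    coIndicator 𝒬 P.rep = 0 ↔ P ∈ 𝒬 := by
  classical
  rw [coIndicator, ite_eq_left_iff, Projectivization.rep_injective.mem_set_image]
  simp [P.rep_nonzero]

theorem coIndicator_eq_zero_or_one {n : ℕ} {K : Type*} [Field K] (𝒬 : Set (PG n K))
    (v : Fin (n + 1) → K) : coIndicator 𝒬 v = 0 ∨ coIndicator 𝒬 v = 1 := by
  rw [coIndicator]
  split_ifs <;> simp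

namespace IsQuasiQuadric

variable {K : Type*} [Field K] {N : PG 4 K} {𝒬 : Set (PG 4 K)}

theorem coIndicator_add_nucleus [Finite K] (h𝒬 : IsQuasiQuadric N 𝒬) (h2 : Nat.card K = 2)
    (v : Fin (4 + 1) → K) : coIndicator 𝒬 (v + N.rep) = 1 - coIndicator 𝒬 v := by
  have hN : coIndicator 𝒬 N.rep = 1 := (coIndicator_eq_zero_or_one _ _).resolve_left fun h =>
    h𝒬.nucleus_notMem (coIndicator_rep_eq_zero.1 h)
  rcases eq_or_ne v 0 with rfl | hv0
  · rw [zero_add, hN, coIndicator_zero, sub_zero]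
  rcases eq_or_ne v N.rep with rfl | hvN
  · rw [add_self_of_natCard_eq_two h2, hN, coIndicator_zero, sub_self]
  have hvN0 : v + N.rep ≠ 0 := fun h => hvN <| by
    rw [← add_left_inj N.rep, h, add_self_of_natCard_eq_two h2]
  obtain ⟨P, hP⟩ : ∃ P : PG 4 K, P.rep = v := ⟨_, Projectivization.rep_mk_of_natCard_eq_two h2 hv0⟩
  obtain ⟨P', hP'⟩ : ∃ P' : PG 4 K, P'.rep = v + N.rep :=
    ⟨_, Projectivization.rep_mk_of_natCard_eq_two h2 hvN0⟩
  have hPN : P ≠ N := fun h => hvN (by rw [← hP, h])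
  have hPP' : P ≠ P' := fun h => N.rep_nonzero <| by
    rwa [h, hP', add_eq_left] at hP
  have hPmem : P.rep ∈ Submodule.span K {N.rep, P.rep} := Submodule.subset_span (by simp)
  have hP'mem : P'.rep ∈ Submodule.span K {N.rep, P.rep} := by
    rw [hP', ← hP]
    exact Submodule.add_mem _ hPmem (Submodule.subset_span (by simp))
  obtain ⟨R, ⟨hR, hRQ⟩, huniq⟩ := h𝒬.existsUnique_mem_span hPN
  have hcases : R = P ∨ R = P' := by
    obtain ⟨a, b, hab⟩ := Submodule.mem_span_pair.1 hR
    rcases eq_zero_or_one_of_natCard_eq_two h2 a with rfl | rfl <;>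
      rcases eq_zero_or_one_of_natCard_eq_two h2 b with rfl | rfl
    · exact absurd (by simpa using hab.symm) R.rep_nonzero
    · exact .inl (Projectivization.rep_injective (by simpa using hab.symm))
    · exact absurd (Projectivization.rep_injective (by simpa using hab.symm)) (h𝒬.ne_nucleus hRQ)
    · right
      apply Projectivization.rep_injective
      rw [hP', ← hP, ← hab, one_smul, one_smul]
      exact add_comm _ _
  rw [← hP', ← hP]
  rcases hcases with rfl | rfl
  · have h1 : coIndicator 𝒬 P'.rep = 1 := (coIndicator_eq_zero_or_one _ _).resolve_left fun h =>
      hPP' (huniq P' ⟨hP'mem, coIndicator_rep_eq_zero.1 h⟩).symm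
    rw [h1, coIndicator_rep_eq_zero.2 hRQ, sub_zero]
  · have h1 : coIndicator 𝒬 P.rep = 1 := (coIndicator_eq_zero_or_one _ _).resolve_left fun h =>
      hPP' (huniq P ⟨hPmem, coIndicator_rep_eq_zero.1 h⟩)
    rw [h1, coIndicator_rep_eq_zero.2 hRQ, sub_self]

/-- The weight of the indicator function on a solid not on the nucleus is `16` minus the number
`5` or `9` of points of `𝒬` in the solid, minus `1` for the zero vector. -/
theorem sum_coIndicator [Fintype K] (h𝒬 : IsQuasiQuadric N 𝒬) (h2 : Nat.card K = 2)
    {v : Fin 4 → Fin (4 + 1) → K} (hv : LinearIndependent K v)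
    (hN : N.rep ∉ Submodule.span K (Set.range v)) :
    ∑ c, coIndicator 𝒬 (Fintype.linearCombination K v c) = 6 ∨
      ∑ c, coIndicator 𝒬 (Fintype.linearCombination K v c) = 10 := by
  classical
  have hW : Module.finrank K (Submodule.span K (Set.range v)) = 3 + 1 := finrank_span_eq_card hv
  have hS := h𝒬.ncard_inter_solid (PGFlat.ofSubmodule _ hW)
    (fun h => hN (PGFlat.mem_ofSubmodule.1 h))
  set S := PGFlat.ofSubmodule _ hW with hSdef
  have hinj : Function.Injective (Fintype.linearCombination K v) :=
    hv.fintypeLinearCombination_injective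
  let B : Finset (Fin 4 → K) := {c | Fintype.linearCombination K v c = 0 ∨
    Fintype.linearCombination K v c ∈ Projectivization.rep '' 𝒬}
  have himage : Fintype.linearCombination K v '' (B : Set (Fin 4 → K)) =
      insert 0 (Projectivization.rep '' (𝒬 ∩ (S.1 : Set (PG 4 K)))) := by
    ext u
    constructor
    · rintro ⟨c, hc, rfl⟩
      rcases (Finset.mem_filter.1 hc).2 with h | ⟨R, hR, hRc⟩
      · exact .inl h
      · refine .inr ⟨R, ⟨hR, PGFlat.mem_ofSubmodule.2 ?_⟩, hRc⟩
        exact (Submodule.mem_span_range_iff_exists_fun K).2 ⟨c, hRc.symm⟩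
    · rintro (rfl | ⟨R, ⟨hR, hRS⟩, rfl⟩)
      · exact ⟨0, by simp [B], map_zero _⟩
      · obtain ⟨c, hc⟩ := (Submodule.mem_span_range_iff_exists_fun K).1
          (PGFlat.mem_ofSubmodule.1 hRS)
        rw [← Fintype.linearCombination_apply] at hc
        exact ⟨c, by simpa [B, hc] using .inr ⟨R, hR, rfl⟩, hc⟩
  have hcard : B.card = (𝒬 ∩ (S.1 : Set (PG 4 K))).ncard + 1 := by
    rw [← Set.ncard_coe_finset, ← Set.ncard_image_of_injective _ hinj, himage,
      Set.ncard_insert_of_notMem, Set.ncard_image_of_injective _ Projectivization.rep_injective]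
    rintro ⟨R, -, hR⟩
    exact R.rep_nonzero hR
  have hsum : ∑ c, coIndicator 𝒬 (Fintype.linearCombination K v c) = 16 - (B.card : ℤ) := by
    have h1 : ∀ c, coIndicator 𝒬 (Fintype.linearCombination K v c) =
        1 - if c ∈ B then 1 else 0 := fun c => by
      rw [coIndicator]
      simp only [B, Finset.mem_filter, Finset.mem_univ, true_and]
      split_ifs <;> rfl
    rw [Nat.card_eq_fintype_card] at h2
    rw [Finset.sum_congr rfl fun c _ => h1 c, Finset.sum_sub_distrib]
    simp [h2]
  rw [h2] at hS
  rw [hsum, hcard]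
  omega

theorem isBentAlong_coIndicator [Fintype K] (h𝒬 : IsQuasiQuadric N 𝒬) (h2 : Nat.card K = 2) :
    IsBentAlong K N.rep (coIndicator 𝒬) where
  eq_zero_or_one := coIndicator_eq_zero_or_one 𝒬
  add_nucleus := h𝒬.coIndicator_add_nucleus h2
  sum_eq _ := h𝒬.sum_coIndicator h2

theorem isNonsingularQuadric [Finite K] (h𝒬 : IsQuasiQuadric N 𝒬) (h2 : Nat.card K = 2) :
    IsNonsingularQuadric 𝒬 := by
  have : Fintype K := Fintype.ofFinite K
  have hG := h𝒬.isBentAlong_coIndicator h2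
  have hV : Module.finrank K (Fin (4 + 1) → K) = 5 := Module.finrank_fin_fun K
  refine ⟨hG.toQuadraticForm h2 hV (coIndicator_zero 𝒬), hG.radical_toQuadraticForm h2 hV _, ?_⟩
  ext P
  change P ∈ 𝒬 ↔ (coIndicator 𝒬 P.rep : K) = 0
  rw [← coIndicator_rep_eq_zero]
  rcases coIndicator_eq_zero_or_one 𝒬 P.rep with h | h <;> simp [h]

end IsQuasiQuadric

theorem mainTheorem4 {K : Type*} [Field K] [Finite K] (q : ℕ) (hq : Nat.card K = q)
    (hq_even : Even q) (N : PG 4 K) (𝒬 : Set (PG 4 K)) (h𝒬 : IsQuasiQuadric N 𝒬) :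
    ConditionI {S : PGSolid K | (𝒬 ∩ (S.1 : Set (PG 4 K))).ncard = (q + 1) ^ 2} ∧
      (q = 2 → IsNonsingularQuadric 𝒬) := by
  subst hq
  exact ⟨h𝒬.conditionI, h𝒬.isNonsingularQuadric⟩
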